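/- Consider the minimum-effort control problem with fixed final time $t_f>0$: steer the system $\dot x=\cos\theta,\ \dot y=\sin\theta,\ \dot\theta=u$ (state $(x,y,\theta)\in\mathbb R^2\times\mathbb S$, $u$ measurable) on $[0,t_f]$ from a given initial state to the final state $(0,0,-\pi/2)$ while minimizing $J=\int_0^{t_f}\tfrac12u(t)^2\,dt$. For $q=(p_x,p_y,c_0)\in\mathbb R^3$ let $Z(t,q)=(X(t),Y(t),\Theta(t))$ be the solution on $[0,t_f]$ of the backward system $$\dot X=-\cos\Theta,\qquad \dot Y=-\sin\Theta,\qquad \dot\Theta=-U,\qquad U(t)=p_xY(t)-p_yX(t)+c_0,$$ with $(X,Y,\Theta)(0)=(0,0,-\pi/2)$. In forward time, $t\mapsto Z(t_f-t,q)$ with control $t\mapsto U(t_f-t)$ is a feasible (extremal) trajectory of the problem with initial state $Z(t_f,q)$. Suppose that this trajectory is not a straight segment, i.e. $\Theta$ is not identically $-\pi/2$ on $[0,t_f]$, and that there are two different instants $t_1,t_2\in(0,t_f)$ at which the curve $(X,Y)$ has the same tangent line, i.e. the velocity vectors $(\cos\Theta(t_1),\sin\Theta(t_1))$ and $(\cos\Theta(t_2),\sin\Theta(t_2))$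 are parallel (with the same or opposite sense) and the displacement $(X(t_1)-X(t_2),\,Y(t_1)-Y(t_2))$ is parallel to them (or zero). When the denominators do not vanish this is the condition $$\frac{Y(t_1)-Y(t_2)}{X(t_1)-X(t_2)}=\tan\Theta(t_1)=\tan\Theta(t_2).$$ Then the extremal trajectory $Z(\cdot,q)$ on $[0,t_f]$ is not optimal: there is a feasible trajectory with the same initial state, the same final state and the same final time $t_f$ and with strictly smaller cost $J$. -/

import Mathlib

open MeasureTheory Set

namespace MECP

noncomputable section

/-- A state `(x, y, θ)` in `ℝ² × 𝕊`; headings are angles modulo `2π`. -/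
structure State where
  x : ℝ
  y : ℝ
  θ : Real.Angle

/-- The prescribed final state `(0, 0, -π/2)`. -/
def finalState : State := ⟨0, 0, ((-(Real.pi / 2) : ℝ) : Real.Angle)⟩

/-- `z` is the (Carathéodory) trajectory of `x' = cos θ`, `y' = sin θ`, `θ' = u` on `[0, tf]`
steered by the integrable control `u`. -/
structure IsTrajectory (tf : ℝ) (z : ℝ → State) (u : ℝ → ℝ) : Prop where
  integrable : IntervalIntegrable u volume 0 tf
  eq_x : ∀ t ∈ Icc 0 tf, (z t).x = (z 0).x + ∫ s in (0 : ℝ)..t, (z s).θ.cos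
  eq_y : ∀ t ∈ Icc 0 tf, (z t).y = (z 0).y + ∫ s in (0 : ℝ)..t, (z s).θ.sin
  eq_θ : ∀ t ∈ Icc 0 tf, (z t).θ = (z 0).θ + ((∫ s in (0 : ℝ)..t, u s : ℝ) : Real.Angle)

/-- The control effort `∫₀^tf u²/2 dt`, with values in `[0, ∞]`. -/
def effort (tf : ℝ) (u : ℝ → ℝ) : ENNReal :=
  ∫⁻ t in Icc 0 tf, ENNReal.ofReal (u t ^ 2 / 2)

/-- The pair `(z, u)` is feasible for the minimum-effort control problem with initial state `z₀`
and fixed final time `tf`: it steers the system from `z₀` to `finalState` in time `tf`. -/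
structure IsFeasible (tf : ℝ) (z₀ : State) (z : ℝ → State) (u : ℝ → ℝ) : Prop where
  traj : IsTrajectory tf z u
  initial : z 0 = z₀
  final : z tf = finalState

/-- The pair `(z, u)` is optimal for the minimum-effort control problem: it is feasible and no
feasible pair with the same initial state and final time has smaller effort. -/
def IsOptimal (tf : ℝ) (z₀ : State) (z : ℝ → State) (u : ℝ → ℝ) : Prop :=
  IsFeasible tf z₀ z u ∧
    ∀ (w : ℝ → State) (v : ℝ → ℝ), IsFeasible tf z₀ w v → effort tf u ≤ effort tf v

/-- The parameter `q = (pₓ, p_y, c₀)`. -/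
structure Param where
  px : ℝ
  py : ℝ
  c0 : ℝ

/-- The extremal control `U(t, q) = pₓ Y(t) - p_y X(t) + c₀` in backward time. -/
def extremalControl (q : Param) (X Y : ℝ → ℝ) (t : ℝ) : ℝ :=
  q.px * Y t - q.py * X t + q.c0

/-- `(X, Y, Θ)` is the solution on `[0, tf]` of the backward `q`-parameterized system, starting
at `(0, 0, -π/2)`; `Θ` is the continuous real-valued lift of the heading. -/
structure IsBackwardSolution (q : Param) (tf : ℝ) (X Y Θ : ℝ → ℝ) : Prop where
  X_zero : X 0 = 0
  Y_zero : Y 0 = 0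
  Θ_zero : Θ 0 = -(Real.pi / 2)
  deriv_X : ∀ t ∈ Icc 0 tf, HasDerivWithinAt X (-Real.cos (Θ t)) (Icc 0 tf) t
  deriv_Y : ∀ t ∈ Icc 0 tf, HasDerivWithinAt Y (-Real.sin (Θ t)) (Icc 0 tf) t
  deriv_Θ : ∀ t ∈ Icc 0 tf, HasDerivWithinAt Θ (-extremalControl q X Y t) (Icc 0 tf) t

/-- The state `Z(t) = (X(t), Y(t), Θ(t))` of the backward system, as a point of `ℝ² × 𝕊`. -/
def backwardState (X Y Θ : ℝ → ℝ) (t : ℝ) : State := ⟨X t, Y t, (Θ t : Real.Angle)⟩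

/-- The tangent lines of the curve `(X, Y)` at the instants `t₁` and `t₂` coincide: the velocity
vectors `(cos Θ, sin Θ)` there are parallel (same or opposite sense), and the displacement between
the two points is parallel to them. Away from vertical tangents and for `X t₁ ≠ X t₂` this says
`(Y t₁ - Y t₂) / (X t₁ - X t₂) = tan (Θ t₁) = tan (Θ t₂)`. -/
def HaveCommonTangent (X Y Θ : ℝ → ℝ) (t₁ t₂ : ℝ) : Prop :=
  Real.cos (Θ t₁) * Real.sin (Θ t₂) = Real.sin (Θ t₁) * Real.cos (Θ t₂) ∧
    (Y t₁ - Y t₂) * Real.cos (Θ t₁) = (X t₁ - X t₂) * Real.sin (Θ t₁)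

end

end MECP

open scoped BoundedContinuousFunction

namespace MECP

/-! In forward time the extremal satisfies the pendulum equation `θ' = u`, `u' = p sin θ + r cos θ`
with `p = p_x`, `r = -p_y`. Reflect the arc between the two tangency instants in the common tangent
line. Both ends of the arc lie on that line, so they stay in place. The heading after the arc
changes by twice a multiple of `π`, so the last arc is traversed as before. The reflected trajectory
is therefore feasible (`integral_cos_sub_reflectHeading`), and its control only changes sign on the
arc, so its effort is the same.

If no feasible trajectory were cheaper, the reflected one would be a minimizer and would obey the
multiplier rule `exists_multipliers_of_isMin`. On the first arc it coincides with the original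
motion. Comparing the two equations there, either the heading is constant on that arc, or the
reflected heading solves the same pendulum equation as the original. In the second case uniqueness
makes the arc equal to its mirror image, hence straight. In both cases a pendulum at rest on an
interval is at rest throughout, which contradicts non-straightness. -/

/-! ### Strict differentiability of the effort and the displacement -/

/-- Mean value inequality for `cos (p + s) + s sin p`, whose derivative is at most `|s|` in absolute
value. -/
theorem abs_cos_add_sub_cos_add_le (p h k : ℝ) :
    |Real.cos (p + h) - Real.cos (p + k) + Real.sin p * (h - k)| ≤ (|h| + |k|) * |h - k| := by
  have hd : ∀ s ∈ Icc (-(|h| + |k|)) (|h| + |k|), HasDerivWithinAt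
      (fun s => Real.cos (p + s) + Real.sin p * s) (-Real.sin (p + s) + Real.sin p)
      (Icc (-(|h| + |k|)) (|h| + |k|)) s := by
    intro s _
    have h1 : HasDerivAt (fun s => p + s) 1 s := (hasDerivAt_id s).const_add p
    have h2 : HasDerivAt (fun s => Real.cos (p + s) + Real.sin p * s)
        (-Real.sin (p + s) * 1 + Real.sin p * 1) s :=
      h1.cos.add ((hasDerivAt_id s).const_mul (Real.sin p))
    rw [mul_one, mul_one] at h2
    exact h2.hasDerivWithinAt
  have hb : ∀ s ∈ Icc (-(|h| + |k|)) (|h| + |k|),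
      ‖-Real.sin (p + s) + Real.sin p‖ ≤ |h| + |k| := by
    intro s hs
    have h1 := Real.lipschitzWith_sin.dist_le_mul p (p + s)
    rw [Real.dist_eq, Real.dist_eq] at h1
    rw [Real.norm_eq_abs, neg_add_eq_sub]
    refine h1.trans ?_
    simpa using abs_le.2 hs
  have hk := abs_le.1 (le_refl |k|)
  have hh := abs_le.1 (le_refl |h|)
  have := (convex_Icc (-(|h| + |k|)) (|h| + |k|)).norm_image_sub_le_of_norm_hasDerivWithin_le hd hb
    (x := k) (y := h) ⟨by linarith [abs_nonneg h], by linarith [abs_nonneg h]⟩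
    ⟨by linarith [abs_nonneg k], by linarith [abs_nonneg k]⟩
  simp only [Real.norm_eq_abs] at this
  convert this using 2
  ring

/-- The multiplier theorem needs strict derivatives, hence an estimate in two points. -/
theorem hasStrictFDerivAt_zero_of_bound {E : Type*} [NormedAddCommGroup E] [NormedSpace ℝ E]
    {f : E → ℝ} {f' : E →L[ℝ] ℝ} {C : ℝ}
    (h : ∀ x y, |f x - f y - f' (x - y)| ≤ C * (‖x‖ + ‖y‖) * ‖x - y‖) :
    HasStrictFDerivAt f f' 0 := by
  rw [hasStrictFDerivAt_iff_isLittleO]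
  refine Asymptotics.IsBigO.trans_isLittleO
    (g := fun q : E × E => (C * (‖q.1‖ + ‖q.2‖)) * ‖q.1 - q.2‖) ?_ ?_
  · refine Asymptotics.isBigO_of_le _ fun q => ?_
    exact (h q.1 q.2).trans (le_abs_self _)
  · have h1 : Filter.Tendsto (fun q : E × E => C * (‖q.1‖ + ‖q.2‖)) (nhds (0, 0)) (nhds 0) := by
      have : Continuous (fun q : E × E => C * (‖q.1‖ + ‖q.2‖)) := by fun_prop
      simpa using this.tendsto (0, 0)
    have h2 := ((Asymptotics.isLittleO_one_iff ℝ).2 h1).mul_isBigO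
      (Asymptotics.isBigO_refl (fun q : E × E => ‖q.1 - q.2‖) (nhds (0, 0)))
    simp only [one_mul] at h2
    exact h2.of_norm_right

/-- Integration against `g` on `[0, T]`, as a functional on bounded continuous functions. -/
noncomputable def integralAgainst {T : ℝ} (hT : 0 ≤ T) {g : ℝ → ℝ}
    (hg : IntervalIntegrable g volume 0 T) : (ℝ →ᵇ ℝ) →L[ℝ] ℝ :=
  LinearMap.mkContinuous
    { toFun := fun v => ∫ t in (0 : ℝ)..T, g t * v t
      map_add' := fun v w => by
        rw [← intervalIntegral.integral_add (hg.mul_continuousOn v.continuous.continuousOn)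
          (hg.mul_continuousOn w.continuous.continuousOn)]
        simp [mul_add]
      map_smul' := fun c v => by
        rw [RingHom.id_apply, smul_eq_mul, ← intervalIntegral.integral_const_mul]
        simp [mul_left_comm] }
    (∫ t in (0 : ℝ)..T, |g t|) fun v => by
      change ‖∫ t in (0 : ℝ)..T, g t * v t‖ ≤ _
      rw [← intervalIntegral.integral_mul_const]
      refine intervalIntegral.norm_integral_le_of_norm_le hT (Filter.Eventually.of_forall ?_)
        (hg.abs.mul_const _)
      intro t _
      rw [norm_mul]
      exact mul_le_mul_of_nonneg_left (v.norm_coe_le_norm t) (norm_nonneg _)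

theorem integralAgainst_apply {T : ℝ} (hT : 0 ≤ T) {g : ℝ → ℝ}
    (hg : IntervalIntegrable g volume 0 T) (v : ℝ →ᵇ ℝ) :
    integralAgainst hT hg v = ∫ t in (0 : ℝ)..T, g t * v t := rfl

theorem continuous_primitive {v : ℝ → ℝ} (hv : Continuous v) (a : ℝ) :
    Continuous fun t => ∫ s in a..t, v s :=
  continuous_iff_continuousAt.2 fun t =>
    (hv.integral_hasStrictDerivAt a t).hasDerivAt.continuousAt

theorem hasDerivAt_integral_to {g : ℝ → ℝ} (hg : Continuous g) (T t : ℝ) :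
    HasDerivAt (fun t => ∫ s in t..T, g s) (-g t) t :=
  intervalIntegral.integral_hasDerivAt_left (hg.intervalIntegrable _ _)
    (hg.stronglyMeasurableAtFilter _ _) hg.continuousAt

/-- Integration by parts without boundary terms: one primitive vanishes at `0`, the other at `T`. It
turns a functional of the heading variation into one of the control variation. -/
theorem integral_mul_primitive {g v : ℝ → ℝ} (hg : Continuous g) (hv : Continuous v) (T : ℝ) :
    ∫ t in (0 : ℝ)..T, g t * ∫ s in (0 : ℝ)..t, v s =
      ∫ t in (0 : ℝ)..T, (∫ s in t..T, g s) * v t := by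
  have h := intervalIntegral.integral_mul_deriv_eq_deriv_mul (a := 0) (b := T)
    (u := fun t => ∫ s in t..T, g s) (u' := fun t => -g t)
    (v := fun t => ∫ s in (0 : ℝ)..t, v s) (v' := v)
    (fun t _ => hasDerivAt_integral_to hg T t)
    (fun t _ => (hv.integral_hasStrictDerivAt 0 t).hasDerivAt)
    (hg.neg.intervalIntegrable _ _) (hv.intervalIntegrable _ _)
  rw [h]
  simp

theorem continuous_integral_to {g : ℝ → ℝ} (hg : Continuous g) (T : ℝ) :
    Continuous fun t => ∫ s in t..T, g s :=
  continuous_iff_continuousAt.2 fun t => (hasDerivAt_integral_to hg T t).continuousAt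

theorem abs_primitive_le {T t : ℝ} (ht : t ∈ Icc 0 T) (v : ℝ →ᵇ ℝ) :
    |∫ s in (0 : ℝ)..t, v s| ≤ T * ‖v‖ := by
  have h := intervalIntegral.norm_integral_le_of_norm_le_const (a := 0) (b := t)
    (f := v) (C := ‖v‖) (fun s _ => v.norm_coe_le_norm s)
  rw [sub_zero, abs_of_nonneg ht.1, Real.norm_eq_abs] at h
  rw [mul_comm T]
  exact h.trans (mul_le_mul_of_nonneg_left ht.2 (norm_nonneg v))

theorem hasStrictFDerivAt_integral_cos {T : ℝ} (hT : 0 ≤ T) {θ : ℝ → ℝ} (hθ : Continuous θ) :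
    HasStrictFDerivAt
      (fun v : ℝ →ᵇ ℝ => ∫ t in (0 : ℝ)..T, Real.cos (θ t + ∫ s in (0 : ℝ)..t, v s))
      (integralAgainst hT ((continuous_integral_to (g := fun s => -Real.sin (θ s))
        (by fun_prop) T).intervalIntegrable 0 T)) 0 := by
  refine hasStrictFDerivAt_zero_of_bound (C := T * T * T) fun v w => ?_
  have hv := continuous_primitive v.continuous 0
  have hw := continuous_primitive w.continuous 0
  rw [integralAgainst_apply, ← integral_mul_primitive (by fun_prop) (v - w).continuous,
    ← intervalIntegral.integral_sub (Continuous.intervalIntegrable (by fun_prop) _ _)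
      (Continuous.intervalIntegrable (by fun_prop) _ _),
    ← intervalIntegral.integral_sub (Continuous.intervalIntegrable (by fun_prop) _ _)
      (Continuous.intervalIntegrable (by
        have := continuous_primitive (v - w).continuous 0
        fun_prop) _ _)]
  have h := intervalIntegral.norm_integral_le_of_norm_le_const (a := 0) (b := T)
    (f := fun t => Real.cos (θ t + ∫ s in (0 : ℝ)..t, v s) -
      Real.cos (θ t + ∫ s in (0 : ℝ)..t, w s) - -Real.sin (θ t) * ∫ s in (0 : ℝ)..t, (v - w) s)
    (C := (T * ‖v‖ + T * ‖w‖) * (T * ‖v - w‖)) fun t ht => by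
      rw [uIoc_of_le hT] at ht
      have ht' := Ioc_subset_Icc_self ht
      have e : (∫ s in (0 : ℝ)..t, (v - w) s) =
          (∫ s in (0 : ℝ)..t, v s) - ∫ s in (0 : ℝ)..t, w s := by
        rw [← intervalIntegral.integral_sub (v.continuous.intervalIntegrable _ _)
          (w.continuous.intervalIntegrable _ _)]
        rfl
      have h1 := abs_primitive_le ht' (v - w)
      have h2 := abs_cos_add_sub_cos_add_le (θ t) (∫ s in (0 : ℝ)..t, v s)
        (∫ s in (0 : ℝ)..t, w s)
      rw [← e] at h2
      rw [neg_mul, sub_neg_eq_add, Real.norm_eq_abs]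
      refine h2.trans ?_
      gcongr
      · exact abs_primitive_le ht' v
      · exact abs_primitive_le ht' w
  rw [sub_zero, abs_of_nonneg hT] at h
  refine h.trans (le_of_eq (by ring))

/-- The remainder is exactly `∫ (v + w)(v - w)/2`. Continuity of `u` is not assumed because the
reflected control jumps. -/
theorem hasStrictFDerivAt_integral_sq {T : ℝ} (hT : 0 ≤ T) {u : ℝ → ℝ}
    (hu : IntervalIntegrable u volume 0 T)
    (hu2 : IntervalIntegrable (fun t => u t ^ 2) volume 0 T) :
    HasStrictFDerivAt (fun v : ℝ →ᵇ ℝ => ∫ t in (0 : ℝ)..T, (u t + v t) ^ 2 / 2)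
      (integralAgainst hT hu) 0 := by
  refine hasStrictFDerivAt_zero_of_bound (C := T) fun v w => ?_
  have key : ∀ v : ℝ →ᵇ ℝ, IntervalIntegrable (fun t => (u t + v t) ^ 2 / 2) volume 0 T := by
    intro v
    have h1 : IntervalIntegrable (fun t => v t ^ 2) volume 0 T :=
      Continuous.intervalIntegrable (by fun_prop) _ _
    have h2 := ((hu2.add ((hu.mul_continuousOn v.continuous.continuousOn).const_mul 2)).add
      h1).div_const 2
    refine h2.congr ?_
    intro t _
    ring
  rw [integralAgainst_apply, ← intervalIntegral.integral_sub (key v) (key w),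
    ← intervalIntegral.integral_sub ((key v).sub (key w))
      (hu.mul_continuousOn (v - w).continuous.continuousOn)]
  have h := intervalIntegral.norm_integral_le_of_norm_le_const (a := 0) (b := T)
    (f := fun t => (u t + v t) ^ 2 / 2 - (u t + w t) ^ 2 / 2 - u t * (v - w) t)
    (C := (‖v‖ + ‖w‖) * ‖v - w‖) fun t _ => by
      have e : (u t + v t) ^ 2 / 2 - (u t + w t) ^ 2 / 2 - u t * (v - w) t =
          ((v t + w t) / 2) * (v - w) t := by
        simp only [BoundedContinuousFunction.coe_sub, Pi.sub_apply]
        ring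
      rw [e, norm_mul]
      refine mul_le_mul ?_ ((v - w).norm_coe_le_norm t) (norm_nonneg _) (by positivity)
      rw [norm_div]
      have h1 := norm_add_le (v t) (w t)
      have h2 := v.norm_coe_le_norm t
      have h3 := w.norm_coe_le_norm t
      have h4 : ‖(2 : ℝ)‖ = 2 := by simp
      rw [h4]
      linarith [norm_nonneg (v t + w t)]
  rw [sub_zero, abs_of_nonneg hT] at h
  refine h.trans (le_of_eq (by ring))

/-! ### Fundamental lemma and multiplier rule -/

theorem ae_eq_zero_of_integralAgainst_eq_zero {T : ℝ} (hT : 0 ≤ T) {g : ℝ → ℝ}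
    (hg : IntervalIntegrable g volume 0 T) (h : ∀ v, integralAgainst hT hg v = 0) :
    ∀ᵐ t, t ∈ Ioo 0 T → g t = 0 := by
  have hg' := (intervalIntegrable_iff_integrableOn_Ioo_of_le hT).1 hg
  refine isOpen_Ioo.ae_eq_zero_of_integral_contDiff_smul_eq_zero hg'.locallyIntegrableOn ?_
  intro φ hφ hφc hφs
  let v : ℝ →ᵇ ℝ := BoundedContinuousFunction.ofNormedAddCommGroup φ hφ.continuous
    (Classical.choose (hφc.exists_bound_of_continuous hφ.continuous))
    (Classical.choose_spec (hφc.exists_bound_of_continuous hφ.continuous))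
  have hv := h v
  rw [integralAgainst_apply, intervalIntegral.integral_of_le hT, integral_Ioc_eq_integral_Ioo] at hv
  rw [← hv, ← setIntegral_eq_integral_of_forall_compl_eq_zero (s := Ioo 0 T)]
  · refine integral_congr_ae (Filter.Eventually.of_forall fun t => ?_)
    exact mul_comm _ _
  · intro t ht
    rw [image_eq_zero_of_notMem_tsupport (fun h' => ht (hφs h')), zero_smul]

/-- Lagrange multiplier rule for minimal effort with prescribed heading and displacement. -/
theorem exists_multipliers_of_isMin {T : ℝ} (hT : 0 ≤ T) {θ u : ℝ → ℝ} (hθ : Continuous θ)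
    (hu : IntervalIntegrable u volume 0 T)
    (hu2 : IntervalIntegrable (fun t => u t ^ 2) volume 0 T)
    (hmin : ∀ v : ℝ →ᵇ ℝ,
      (∫ t in (0 : ℝ)..T, Real.cos (θ t + ∫ s in (0 : ℝ)..t, v s)) =
        (∫ t in (0 : ℝ)..T, Real.cos (θ t)) →
      (∫ t in (0 : ℝ)..T, Real.sin (θ t + ∫ s in (0 : ℝ)..t, v s)) =
        (∫ t in (0 : ℝ)..T, Real.sin (θ t)) →
      (∫ t in (0 : ℝ)..T, v t) = 0 →
      (∫ t in (0 : ℝ)..T, u t ^ 2 / 2) ≤ ∫ t in (0 : ℝ)..T, (u t + v t) ^ 2 / 2) :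
    ∃ a b c d : ℝ, ¬ (a = 0 ∧ b = 0 ∧ c = 0 ∧ d = 0) ∧
      ∀ᵐ t, t ∈ Ioo 0 T →
        d * u t + c + ∫ s in t..T, (-a * Real.sin (θ s) + b * Real.cos (θ s)) = 0 := by
  have h1 := hasStrictFDerivAt_integral_cos hT hθ
  -- A shift by `π/2` turns the cosine functional into the sine functional.
  have h2 := hasStrictFDerivAt_integral_cos hT (θ := fun t => θ t - Real.pi / 2) (by fun_prop)
  have h3 : HasStrictFDerivAt (fun v : ℝ →ᵇ ℝ => ∫ t in (0 : ℝ)..T, v t)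
      (integralAgainst hT ((continuous_const (y := (1 : ℝ))).intervalIntegrable 0 T)) 0 := by
    have := (integralAgainst hT
      ((continuous_const (y := (1 : ℝ))).intervalIntegrable 0 T)).hasStrictFDerivAt (x := 0)
    refine this.congr_of_eventuallyEq (Filter.Eventually.of_forall fun v => ?_)
    simp [integralAgainst_apply]
  have h4 := hasStrictFDerivAt_integral_sq hT hu hu2
  have hs : ∀ x y : ℝ, Real.cos (x - Real.pi / 2 + y) = Real.sin (x + y) := by
    intro x y
    rw [← Real.cos_sub_pi_div_two]
    ring_nf
  have hs' : ∀ x : ℝ, Real.sin (x - Real.pi / 2) = -Real.cos x := fun x =>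
    Real.sin_sub_pi_div_two x
  simp only [hs, hs', neg_neg] at h2
  have hG1 := continuous_integral_to (g := fun s => -Real.sin (θ s)) (by fun_prop) T
  have hG2 := continuous_integral_to (g := fun s => Real.cos (θ s)) (by fun_prop) T
  -- No regularity of the constraints is required, so the cost multiplier `d` may vanish.
  obtain ⟨Λ, d, hne, hsum⟩ := IsLocalExtrOn.exists_multipliers_of_hasStrictFDerivAt
    (φ := fun v : ℝ →ᵇ ℝ => ∫ t in (0 : ℝ)..T, (u t + v t) ^ 2 / 2) (x₀ := 0)
    (f := ![fun v : ℝ →ᵇ ℝ => ∫ t in (0 : ℝ)..T, Real.cos (θ t + ∫ s in (0 : ℝ)..t, v s),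
      fun v : ℝ →ᵇ ℝ => ∫ t in (0 : ℝ)..T, Real.sin (θ t + ∫ s in (0 : ℝ)..t, v s),
      fun v : ℝ →ᵇ ℝ => ∫ t in (0 : ℝ)..T, v t])
    (f' := ![integralAgainst hT (g := fun t => ∫ s in t..T, -Real.sin (θ s))
        (hG1.intervalIntegrable 0 T),
      integralAgainst hT (g := fun t => ∫ s in t..T, Real.cos (θ s)) (hG2.intervalIntegrable 0 T),
      integralAgainst hT ((continuous_const (y := (1 : ℝ))).intervalIntegrable 0 T)])
    (Or.inl <| IsMinOn.localize <| fun v hv => by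
      have e1 := hv 0
      have e2 := hv 1
      have e3 := hv 2
      simp at e1 e2 e3
      simpa using hmin v e1 e2 e3)
    (by
      intro i
      fin_cases i
      · exact h1
      · exact h2
      · exact h3) h4
  refine ⟨Λ 0, Λ 1, Λ 2, d, ?_, ?_⟩
  · rintro ⟨e0, e1, e2, e3⟩
    refine hne (Prod.ext (funext fun i => ?_) e3)
    fin_cases i
    · exact e0
    · exact e1
    · exact e2
  have hg : IntervalIntegrable (fun t => d * u t + Λ 2 +
      ∫ s in t..T, (-Λ 0 * Real.sin (θ s) + Λ 1 * Real.cos (θ s))) volume 0 T := by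
    refine ((hu.const_mul d).add intervalIntegrable_const).add
      (Continuous.intervalIntegrable ?_ _ _)
    exact continuous_integral_to (by fun_prop) T
  refine ae_eq_zero_of_integralAgainst_eq_zero hT hg fun v => ?_
  have hv := congrArg (fun L : (ℝ →ᵇ ℝ) →L[ℝ] ℝ => L v) hsum
  simp only [Fin.sum_univ_three, add_apply, smul_apply,
    Matrix.cons_val_zero, Matrix.cons_val_one, Matrix.cons_val, integralAgainst_apply,
    smul_eq_mul, zero_apply, ← intervalIntegral.integral_const_mul] at hv
  have i1 : IntervalIntegrable (fun t => Λ 0 * ((∫ s in t..T, -Real.sin (θ s)) * v t)) volume 0 T :=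
    Continuous.intervalIntegrable (by fun_prop) _ _
  have i2 : IntervalIntegrable (fun t => Λ 1 * ((∫ s in t..T, Real.cos (θ s)) * v t)) volume 0 T :=
    Continuous.intervalIntegrable (by fun_prop) _ _
  have i3 : IntervalIntegrable (fun t => Λ 2 * (1 * v t)) volume 0 T :=
    Continuous.intervalIntegrable (by fun_prop) _ _
  have i4 : IntervalIntegrable (fun t => d * (u t * v t)) volume 0 T :=
    (hu.mul_continuousOn v.continuous.continuousOn).const_mul d
  rw [← intervalIntegral.integral_add i1 i2, ← intervalIntegral.integral_add (i1.add i2) i3,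
    ← intervalIntegral.integral_add ((i1.add i2).add i3) i4] at hv
  rw [integralAgainst_apply]
  refine Eq.trans ?_ hv
  refine intervalIntegral.integral_congr fun t _ => ?_
  have e : (∫ s in t..T, (-Λ 0 * Real.sin (θ s) + Λ 1 * Real.cos (θ s))) =
      Λ 0 * (∫ s in t..T, -Real.sin (θ s)) + Λ 1 * ∫ s in t..T, Real.cos (θ s) := by
    rw [← intervalIntegral.integral_const_mul, ← intervalIntegral.integral_const_mul,
      ← intervalIntegral.integral_add (Continuous.intervalIntegrable (by fun_prop) _ _)
        (Continuous.intervalIntegrable (by fun_prop) _ _)]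
    simp
  simp only [e]
  ring

/-! ### The pendulum equation -/

theorem exists_lipschitzWith_pendulum (p r : ℝ) :
    ∃ K, LipschitzWith K fun z : ℝ × ℝ => (z.2, p * Real.sin z.1 + r * Real.cos z.1) := by
  refine ⟨_, LipschitzWith.prodMk LipschitzWith.prod_snd
    (LipschitzWith.add (Kf := ‖p‖₊) (Kg := ‖r‖₊) ?_ ?_)⟩
  · refine LipschitzWith.of_dist_le_mul fun z w => ?_
    have h := Real.lipschitzWith_sin.dist_le_mul z.1 w.1
    rw [Real.dist_eq] at h ⊢
    rw [← mul_sub, abs_mul]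
    refine mul_le_mul_of_nonneg_left (h.trans ?_) (abs_nonneg p)
    simp [Prod.dist_eq]
  · refine LipschitzWith.of_dist_le_mul fun z w => ?_
    have h := Real.lipschitzWith_cos.dist_le_mul z.1 w.1
    rw [Real.dist_eq] at h ⊢
    rw [← mul_sub, abs_mul]
    refine mul_le_mul_of_nonneg_left (h.trans ?_) (abs_nonneg r)
    simp [Prod.dist_eq]

theorem pendulum_unique {p r T t₀ : ℝ} {θ u θ' u' : ℝ → ℝ}
    (hθ : ∀ t ∈ Ioo 0 T, HasDerivAt θ (u t) t)
    (hu : ∀ t ∈ Ioo 0 T, HasDerivAt u (p * Real.sin (θ t) + r * Real.cos (θ t)) t)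
    (hθ' : ∀ t ∈ Ioo 0 T, HasDerivAt θ' (u' t) t)
    (hu' : ∀ t ∈ Ioo 0 T, HasDerivAt u' (p * Real.sin (θ' t) + r * Real.cos (θ' t)) t)
    (ht₀ : t₀ ∈ Ioo 0 T) (h1 : θ t₀ = θ' t₀) (h2 : u t₀ = u' t₀) :
    EqOn θ θ' (Ioo 0 T) := by
  obtain ⟨K, hK⟩ := exists_lipschitzWith_pendulum p r
  have := ODE_solution_unique_of_mem_Ioo
    (v := fun _ z => (z.2, p * Real.sin z.1 + r * Real.cos z.1)) (s := fun _ => univ) (K := K)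
    (f := fun t => (θ t, u t)) (g := fun t => (θ' t, u' t))
    (fun t _ => hK.lipschitzOnWith) ht₀
    (fun t ht => ⟨(hθ t ht).prodMk (hu t ht), mem_univ _⟩)
    (fun t ht => ⟨(hθ' t ht).prodMk (hu' t ht), mem_univ _⟩) (Prod.ext h1 h2)
  exact fun t ht => congrArg Prod.fst (this ht)

/-- A pendulum motion at rest on an open time interval is at rest for all times. -/
theorem pendulum_const_of_const {p r T α β k : ℝ} {θ u : ℝ → ℝ}
    (hθ : ∀ t ∈ Ioo 0 T, HasDerivAt θ (u t) t)
    (hu : ∀ t ∈ Ioo 0 T, HasDerivAt u (p * Real.sin (θ t) + r * Real.cos (θ t)) t)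
    (hα : 0 ≤ α) (hαβ : α < β) (hβ : β ≤ T) (hk : ∀ t ∈ Ioo α β, θ t = k) :
    ∀ t ∈ Ioo 0 T, θ t = k := by
  have hsub : Ioo α β ⊆ Ioo 0 T := Ioo_subset_Ioo hα hβ
  have hu0 : ∀ t ∈ Ioo α β, u t = 0 := fun t ht =>
    ((hθ t (hsub ht)).congr_of_eventuallyEq (Filter.EventuallyEq.symm
      (Filter.eventually_of_mem (Ioo_mem_nhds ht.1 ht.2) hk))).unique (hasDerivAt_const t k)
  have hm : (α + β) / 2 ∈ Ioo α β := ⟨by linarith, by linarith⟩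
  -- As `u` vanishes near the midpoint, so does `u'`; hence `(k, 0)` is an equilibrium, to be
  -- compared with the motion by uniqueness.
  have hf := ((hu _ (hsub hm)).congr_of_eventuallyEq (Filter.EventuallyEq.symm
      (Filter.eventually_of_mem (Ioo_mem_nhds hm.1 hm.2) hu0))).unique (hasDerivAt_const _ 0)
  rw [hk _ hm] at hf
  exact pendulum_unique (θ' := fun _ => k) (u' := fun _ => 0) hθ hu
    (fun t _ => hasDerivAt_const t k) (fun t _ => by rw [hf]; exact hasDerivAt_const t 0)
    (hsub hm) (hk _ hm) (hu0 _ hm)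

/-- Where `u ≠ 0`, differentiating makes `(a, b)` orthogonal to `(cos θ, -sin θ)` as well as to
`(sin θ, cos θ)`, an orthonormal basis. -/
theorem const_of_sin_cos_relation {θ u : ℝ → ℝ} {a b α β : ℝ} (hab : ¬ (a = 0 ∧ b = 0))
    (hθ : ∀ t ∈ Ioo α β, HasDerivAt θ (u t) t)
    (h : ∀ t ∈ Ioo α β, a * Real.sin (θ t) + b * Real.cos (θ t) = 0) :
    ∃ k, ∀ t ∈ Ioo α β, θ t = k := by
  refine isOpen_Ioo.exists_is_const_of_deriv_eq_zero isPreconnected_Ioo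
    (fun t ht => (hθ t ht).differentiableAt.differentiableWithinAt) fun t ht => ?_
  rw [(hθ t ht).deriv]
  have h1 : HasDerivAt (fun t => a * Real.sin (θ t) + b * Real.cos (θ t))
      (a * (Real.cos (θ t) * u t) + b * (-Real.sin (θ t) * u t)) t :=
    ((hθ t ht).sin.const_mul a).add ((hθ t ht).cos.const_mul b)
  have h2 := (h1.congr_of_eventuallyEq (Filter.EventuallyEq.symm
      (Filter.eventually_of_mem (Ioo_mem_nhds ht.1 ht.2) h))).unique (hasDerivAt_const _ 0)
  by_contra hne
  have h3 : a * Real.cos (θ t) - b * Real.sin (θ t) = 0 := by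
    apply mul_right_cancel₀ hne
    linarith
  have h4 := h t ht
  have h5 := Real.sin_sq_add_cos_sq (θ t)
  refine hab ⟨?_, ?_⟩
  · linear_combination Real.sin (θ t) * h4 + Real.cos (θ t) * h3 - a * h5
  · linear_combination Real.cos (θ t) * h4 - Real.sin (θ t) * h3 - b * h5

/-! ### Reflection of an arc -/

/-- The heading `θ` with the arc over `[s₁, s₂]` reflected about the direction `θ s₁`. -/
noncomputable def reflectHeading (θ : ℝ → ℝ) (s₁ s₂ t : ℝ) : ℝ :=
  if t ≤ s₁ then θ t else if t ≤ s₂ then 2 * θ s₁ - θ t else θ t + 2 * (θ s₁ - θ s₂)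

/-- The control `u` with its sign changed on `(s₁, s₂]`. -/
noncomputable def reflectControl (u : ℝ → ℝ) (s₁ s₂ t : ℝ) : ℝ :=
  u t - 2 * (Ioc s₁ s₂).indicator u t

section Reflection

variable {θ u : ℝ → ℝ} {s₁ s₂ T : ℝ}

theorem reflectHeading_of_le {t : ℝ} (ht : t ≤ s₁) : reflectHeading θ s₁ s₂ t = θ t :=
  if_pos ht

theorem reflectHeading_of_mem {t : ℝ} (ht : s₁ < t) (ht' : t ≤ s₂) :
    reflectHeading θ s₁ s₂ t = 2 * θ s₁ - θ t := by
  rw [reflectHeading, if_neg (not_le.2 ht), if_pos ht']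

theorem reflectHeading_of_lt {t : ℝ} (h : s₁ < s₂) (ht : s₂ < t) :
    reflectHeading θ s₁ s₂ t = θ t + 2 * (θ s₁ - θ s₂) := by
  rw [reflectHeading, if_neg (not_le.2 (h.trans ht)), if_neg (not_le.2 ht)]

theorem continuous_reflectHeading (hθ : Continuous θ) (h : s₁ < s₂) :
    Continuous (reflectHeading θ s₁ s₂) := by
  refine Continuous.if_le hθ (Continuous.if_le (by fun_prop) (by fun_prop) continuous_id
    continuous_const ?_) continuous_id continuous_const ?_
  · rintro t rfl
    ring
  · rintro t rfl
    rw [if_pos h.le]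
    ring

theorem reflectControl_sq (t : ℝ) : reflectControl u s₁ s₂ t ^ 2 = u t ^ 2 := by
  by_cases ht : t ∈ Ioc s₁ s₂
  · rw [reflectControl, indicator_of_mem ht]
    ring
  · rw [reflectControl, indicator_of_notMem ht]
    ring

theorem intervalIntegrable_reflectControl (hu : Continuous u) (a b : ℝ) :
    IntervalIntegrable (reflectControl u s₁ s₂) volume a b := by
  have h := hu.intervalIntegrable (μ := volume) a b
  refine h.sub (IntervalIntegrable.const_mul ?_ 2)
  exact ⟨h.1.indicator measurableSet_Ioc, h.2.indicator measurableSet_Ioc⟩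

theorem hasDerivAt_reflectHeading (hθ : ∀ t, HasDerivAt θ (u t) t) (h : s₁ < s₂) {t : ℝ}
    (h1 : t ≠ s₁) (h2 : t ≠ s₂) :
    HasDerivAt (reflectHeading θ s₁ s₂) (reflectControl u s₁ s₂ t) t := by
  rcases lt_or_gt_of_ne h1 with h1 | h1
  · rw [reflectControl, indicator_of_notMem (fun h' => h1.not_gt h'.1), mul_zero, sub_zero]
    refine (hθ t).congr_of_eventuallyEq ?_
    filter_upwards [Iio_mem_nhds h1] with s hs
    exact reflectHeading_of_le (le_of_lt hs)
  rcases lt_or_gt_of_ne h2 with h2 | h2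
  · rw [reflectControl, indicator_of_mem (show t ∈ Ioc s₁ s₂ from ⟨h1, h2.le⟩), two_mul, sub_add_cancel_left]
    refine ((hθ t).const_sub (2 * θ s₁)).congr_of_eventuallyEq ?_
    filter_upwards [Ioo_mem_nhds h1 h2] with s hs
    exact reflectHeading_of_mem hs.1 hs.2.le
  · rw [reflectControl, indicator_of_notMem (fun h' => h2.not_ge h'.2), mul_zero, sub_zero]
    refine ((hθ t).add_const (2 * (θ s₁ - θ s₂))).congr_of_eventuallyEq ?_
    filter_upwards [Ioi_mem_nhds h2] with s hs
    exact reflectHeading_of_lt h hs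

theorem reflectHeading_eq_integral (hθ : ∀ t, HasDerivAt θ (u t) t) (hu : Continuous u)
    (h0 : 0 ≤ s₁) (h : s₁ < s₂) {t : ℝ} (ht : 0 ≤ t) :
    reflectHeading θ s₁ s₂ t = θ 0 + ∫ s in (0 : ℝ)..t, reflectControl u s₁ s₂ s := by
  have hc : Continuous θ := continuous_iff_continuousAt.2 fun t => (hθ t).continuousAt
  rw [integral_eq_of_hasDerivAt_off_countable_of_le (reflectHeading θ s₁ s₂) _ ht
    (s := {s₁, s₂}) (Set.toFinite _).countable (continuous_reflectHeading hc h).continuousOn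
    (fun t ht => ?_) (intervalIntegrable_reflectControl hu 0 t), reflectHeading_of_le h0]
  · ring
  · have := ht.2
    simp only [mem_insert_iff, mem_singleton_iff, not_or] at this
    exact hasDerivAt_reflectHeading hθ h this.1 this.2

/-- On the arc the integrands differ by `2 sin (θ s₁ - φ) sin (θ t - θ s₁)`, whose integral vanishes
because the chord lies along the tangent. Beyond it the headings agree modulo `2π`. The phases `φ =
0` and `φ = π/2` give the two coordinates. -/
theorem integral_cos_sub_reflectHeading (hθ : Continuous θ) (h0 : 0 ≤ s₁) (h : s₁ < s₂)
    (hT : s₂ ≤ T) (hpar : Real.sin (θ s₁ - θ s₂) = 0)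
    (hdisp : ∫ t in s₁..s₂, Real.sin (θ t - θ s₁) = 0) (φ : ℝ) :
    ∫ t in (0 : ℝ)..T, Real.cos (reflectHeading θ s₁ s₂ t - φ) =
      ∫ t in (0 : ℝ)..T, Real.cos (θ t - φ) := by
  have hr := continuous_reflectHeading hθ h
  have i1 : ∀ a b, IntervalIntegrable (fun t => Real.cos (reflectHeading θ s₁ s₂ t - φ))
      volume a b := fun a b => Continuous.intervalIntegrable (by fun_prop) _ _
  have i2 : ∀ a b, IntervalIntegrable (fun t => Real.cos (θ t - φ))
      volume a b := fun a b => Continuous.intervalIntegrable (by fun_prop) _ _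
  rw [← intervalIntegral.integral_add_adjacent_intervals (i1 0 s₁) (i1 s₁ T),
    ← intervalIntegral.integral_add_adjacent_intervals (i1 s₁ s₂) (i1 s₂ T),
    ← intervalIntegral.integral_add_adjacent_intervals (i2 0 s₁) (i2 s₁ T),
    ← intervalIntegral.integral_add_adjacent_intervals (i2 s₁ s₂) (i2 s₂ T)]
  congr 1
  · refine intervalIntegral.integral_congr fun t ht => ?_
    rw [uIcc_of_le h0] at ht
    simp only [reflectHeading_of_le ht.2]
  congr 1
  · rw [← sub_eq_zero, ← intervalIntegral.integral_sub (i1 _ _) (i2 _ _)]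
    have e : ∫ t in s₁..s₂, (Real.cos (reflectHeading θ s₁ s₂ t - φ) - Real.cos (θ t - φ)) =
        ∫ t in s₁..s₂, 2 * Real.sin (θ s₁ - φ) * Real.sin (θ t - θ s₁) := by
      rw [intervalIntegral.integral_of_le h.le, intervalIntegral.integral_of_le h.le]
      refine setIntegral_congr_fun measurableSet_Ioc fun t ht => ?_
      simp only [reflectHeading_of_mem ht.1 ht.2]
      rw [show 2 * θ s₁ - θ t - φ = (θ s₁ - φ) - (θ t - θ s₁) by ring,
        show θ t - φ = (θ s₁ - φ) + (θ t - θ s₁) by ring, Real.cos_sub, Real.cos_add]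
      ring
    rw [e, intervalIntegral.integral_const_mul, hdisp, mul_zero]
  · rw [intervalIntegral.integral_of_le hT, intervalIntegral.integral_of_le hT]
    refine setIntegral_congr_fun measurableSet_Ioc fun t ht => ?_
    simp only [reflectHeading_of_lt h ht.1]
    rw [show θ t + 2 * (θ s₁ - θ s₂) - φ = (θ t - φ) + 2 * (θ s₁ - θ s₂) by ring, Real.cos_add,
      Real.cos_two_mul, Real.sin_two_mul, hpar]
    have := Real.sin_sq_add_cos_sq (θ s₁ - θ s₂)
    rw [hpar] at this
    linear_combination 2 * Real.cos (θ t - φ) * this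

end Reflection

/-! ### The reflected extremal is not a minimizer -/

/-- Along a non-straight extremal with a double tangent, the effort can be strictly decreased. -/
theorem exists_control_of_double_tangent {p r T s₁ s₂ : ℝ} {θ u : ℝ → ℝ} (hu : Continuous u)
    (hθ : ∀ t, HasDerivAt θ (u t) t)
    (hu' : ∀ t ∈ Ioo 0 T, HasDerivAt u (p * Real.sin (θ t) + r * Real.cos (θ t)) t)
    (h0 : 0 < s₁) (h : s₁ < s₂) (hT : s₂ < T) (hpar : Real.sin (θ s₁ - θ s₂) = 0)
    (hdisp : ∫ t in s₁..s₂, Real.sin (θ t - θ s₁) = 0)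
    (hne : ¬ ∃ k, ∀ t ∈ Ioo 0 T, θ t = k) :
    ∃ w : ℝ → ℝ, IntervalIntegrable w volume 0 T ∧
      IntervalIntegrable (fun t => w t ^ 2 / 2) volume 0 T ∧
      Real.sin ((θ 0 + ∫ s in (0 : ℝ)..T, w s) - θ T) = 0 ∧
      Real.cos ((θ 0 + ∫ s in (0 : ℝ)..T, w s) - θ T) = 1 ∧
      (∫ t in (0 : ℝ)..T, Real.cos (θ 0 + ∫ s in (0 : ℝ)..t, w s)) =
        (∫ t in (0 : ℝ)..T, Real.cos (θ t)) ∧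
      (∫ t in (0 : ℝ)..T, Real.sin (θ 0 + ∫ s in (0 : ℝ)..t, w s)) =
        (∫ t in (0 : ℝ)..T, Real.sin (θ t)) ∧
      (∫ t in (0 : ℝ)..T, w t ^ 2 / 2) < ∫ t in (0 : ℝ)..T, u t ^ 2 / 2 := by
  by_contra hcon
  have hT0 : 0 ≤ T := (h0.trans (h.trans hT)).le
  have hc : Continuous θ := continuous_iff_continuousAt.2 fun t => (hθ t).continuousAt
  set ρ := reflectHeading θ s₁ s₂ with hρ
  set ν := reflectControl u s₁ s₂ with hν
  have hρc : Continuous ρ := continuous_reflectHeading hc h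
  have hνi : ∀ a b, IntervalIntegrable ν volume a b := intervalIntegrable_reflectControl hu
  have hνsq : ∀ t, ν t ^ 2 = u t ^ 2 := reflectControl_sq
  have hρν : ∀ {t}, 0 ≤ t → ρ t = θ 0 + ∫ s in (0 : ℝ)..t, ν s :=
    fun ht => reflectHeading_eq_integral hθ hu h0.le h ht
  have hνi2 : IntervalIntegrable (fun t => ν t ^ 2) volume 0 T := by
    simp only [hνsq]
    exact Continuous.intervalIntegrable (by fun_prop) _ _
  have hcos := integral_cos_sub_reflectHeading hc h0.le h hT.le hpar hdisp 0
  have hsin := integral_cos_sub_reflectHeading hc h0.le h hT.le hpar hdisp (Real.pi / 2)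
  simp only [sub_zero, Real.cos_sub_pi_div_two, ← hρ] at hcos hsin
  -- A cheaper admissible `ν + v` would be the control denied by `hcon`, since `ν` has the effort of
  -- `u`.
  obtain ⟨a, b, c, d, hne0, hae⟩ := exists_multipliers_of_isMin hT0 hρc (hνi 0 T) hνi2 (by
    intro v e1 e2 e3
    by_contra hlt
    rw [not_le] at hlt
    have hadd : ∀ {t}, 0 ≤ t → θ 0 + ∫ s in (0 : ℝ)..t, (ν s + v s) =
        ρ t + ∫ s in (0 : ℝ)..t, v s := by
      intro t ht
      rw [intervalIntegral.integral_add (hνi 0 t) (v.continuous.intervalIntegrable 0 t), hρν ht,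
        add_assoc]
    have hend : (θ 0 + ∫ s in (0 : ℝ)..T, (ν s + v s)) - θ T = 2 * (θ s₁ - θ s₂) := by
      rw [hadd hT0, e3, hρ, reflectHeading_of_lt h hT]
      ring
    refine hcon ⟨fun t => ν t + v t, (hνi 0 T).add (v.continuous.intervalIntegrable 0 T),
      ?_, ?_, ?_, ?_, ?_, ?_⟩
    · have h1 : IntervalIntegrable (fun t => v t ^ 2) volume 0 T :=
        Continuous.intervalIntegrable (by fun_prop) _ _
      refine (((hνi2.add (((hνi 0 T).mul_continuousOn
        v.continuous.continuousOn).const_mul 2)).add h1).div_const 2).congr ?_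
      intro t _
      ring
    · rw [hend, Real.sin_two_mul, hpar]
      ring
    · rw [hend, Real.cos_two_mul, Real.cos_sq', hpar]
      ring
    · rw [← hcos, ← e1]
      refine intervalIntegral.integral_congr fun t ht => ?_
      rw [uIcc_of_le hT0] at ht
      simp only [hadd ht.1]
    · rw [← hsin, ← e2]
      refine intervalIntegral.integral_congr fun t ht => ?_
      rw [uIcc_of_le hT0] at ht
      simp only [hadd ht.1]
    · simpa only [hνsq] using hlt)
  have hρθ : ∀ t ∈ Ioo 0 s₁, ρ t = θ t := fun t ht => reflectHeading_of_le ht.2.le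
  have hconst : ∀ α β, 0 ≤ α → α < β → β ≤ T → ¬ ∃ k, ∀ t ∈ Ioo α β, θ t = k := by
    rintro α β hα hαβ hβ ⟨k, hk⟩
    exact hne ⟨k, pendulum_const_of_const (fun t _ => hθ t) hu' hα hαβ hβ hk⟩
  have hs₁T : s₁ ≤ T := (h.trans hT).le
  have hsub : Ioo 0 s₁ ⊆ Ioo 0 T := Ioo_subset_Ioo_right hs₁T
  set g : ℝ → ℝ := fun s => -a * Real.sin (ρ s) + b * Real.cos (ρ s) with hg
  have hgc : Continuous g := by fun_prop
  set A : ℝ → ℝ := fun t => c + ∫ s in t..T, g s with hA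
  have hAd : ∀ t, HasDerivAt A (-g t) t := fun t => (hasDerivAt_integral_to hgc T t).const_add c
  have hAc : Continuous A := continuous_iff_continuousAt.2 fun t => (hAd t).continuousAt
  -- Integrating the almost-everywhere identity `d ν = -A` shows that `d ρ` is differentiable on all
  -- of `(0, T)`, even where `ν` jumps.
  have hdρ : ∀ t ∈ Icc 0 T, d * (ρ t - θ 0) = ∫ s in (0 : ℝ)..t, -A s := by
    intro t ht
    rw [hρν ht.1, add_sub_cancel_left, ← intervalIntegral.integral_const_mul,
      intervalIntegral.integral_of_le ht.1, intervalIntegral.integral_of_le ht.1,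
      integral_Ioc_eq_integral_Ioo, integral_Ioc_eq_integral_Ioo]
    refine setIntegral_congr_ae measurableSet_Ioo ?_
    filter_upwards [hae] with s hs hst
    have := hs (Ioo_subset_Ioo_right ht.2 hst)
    simp only [hA, hg]
    linarith
  have hdA : ∀ t ∈ Ioo 0 T, HasDerivAt (fun t => d * (ρ t - θ 0)) (-A t) t := by
    intro t ht
    refine ((hAc.neg.integral_hasStrictDerivAt 0 t).hasDerivAt).congr_of_eventuallyEq ?_
    filter_upwards [Ioo_mem_nhds ht.1 ht.2] with s hs
    exact hdρ s (Ioo_subset_Icc_self hs)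
  have hduA : ∀ t ∈ Ioo 0 s₁, d * u t = -A t := by
    intro t ht
    refine HasDerivAt.unique ?_ (hdA t (hsub ht))
    refine (((hθ t).sub_const (θ 0)).const_mul d).congr_of_eventuallyEq ?_
    filter_upwards [Ioo_mem_nhds ht.1 ht.2] with s hs
    rw [hρθ s hs]
  -- Differentiate `d u = -A` and compare with the pendulum equation for `u`.
  have hrel : ∀ t ∈ Ioo 0 s₁,
      (d * p + a) * Real.sin (θ t) + (d * r - b) * Real.cos (θ t) = 0 := by
    intro t ht
    have h1 := (hu' t (hsub ht)).const_mul d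
    have h2 := (hAd t).neg
    have h3 := (h2.congr_of_eventuallyEq (f₁ := fun t => d * u t)
      (Filter.eventually_of_mem (Ioo_mem_nhds ht.1 ht.2) hduA)).unique h1
    simp only [hg, hρθ t ht] at h3
    linarith
  by_cases hcoef : d * p + a = 0 ∧ d * r - b = 0
  · by_cases hd : d = 0
    · rw [hd, zero_mul, zero_mul, zero_add, zero_sub, neg_eq_zero] at hcoef
      -- Abnormal case: `a = b = d = 0` leaves `A = c`, and `d u = -A` gives `c = 0`.
      refine hne0 ⟨hcoef.1, hcoef.2, ?_, hd⟩
      have hm : s₁ / 2 ∈ Ioo 0 s₁ := ⟨by linarith, by linarith⟩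
      have := hduA _ hm
      simp only [hA, hg, hcoef.1, hcoef.2, hd] at this
      simpa using this.symm
    -- Normal case: `a = -d p` and `b = d r`, so `ρ` with rate `-A / d` obeys the same pendulum
    -- equation as `θ`.
    · have hρd : ∀ t ∈ Ioo 0 T, HasDerivAt ρ (-A t / d) t := by
        intro t ht
        have h1 := ((hdA t ht).div_const d).add_const (θ 0)
        refine h1.congr_of_eventuallyEq (Filter.Eventually.of_forall fun s => ?_)
        simp only
        field_simp
        ring
      have hρu : ∀ t ∈ Ioo 0 T, HasDerivAt (fun t => -A t / d)
          (p * Real.sin (ρ t) + r * Real.cos (ρ t)) t := by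
        intro t _
        refine ((hAd t).neg.div_const d).congr_deriv ?_
        rw [div_eq_iff hd]
        simp only [hg]
        linear_combination -Real.sin (ρ t) * hcoef.1 - Real.cos (ρ t) * hcoef.2
      have hm : s₁ / 2 ∈ Ioo 0 s₁ := ⟨by linarith, by linarith⟩
      have heq := pendulum_unique (fun t _ => hθ t) hu' hρd hρu (hsub hm) (hρθ _ hm).symm
        (by rw [← hduA _ hm]; field_simp)
      -- On the reflected arc `θ = ρ = 2 θ s₁ - θ`.
      refine hconst s₁ s₂ h0.le h hT.le ⟨θ s₁, fun t ht => ?_⟩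
      have h1 := heq (Ioo_subset_Ioo h0.le hT.le ht)
      rw [hρ, reflectHeading_of_mem ht.1 ht.2.le] at h1
      linarith
  · exact hconst 0 s₁ le_rfl h0 hs₁T (const_of_sin_cos_relation hcoef (fun t _ => hθ t) hrel)

/-! ### Time reversal and the backward system -/

theorem continuousOn_comp_sub {T : ℝ} {f : ℝ → ℝ} (hf : ContinuousOn f (Icc 0 T)) :
    ContinuousOn (fun t => f (T - t)) (Icc 0 T) :=
  hf.comp (by fun_prop) fun t ht => ⟨by linarith [ht.2], by linarith [ht.1]⟩

theorem hasDerivAt_comp_sub {T : ℝ} {f f' : ℝ → ℝ}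
    (hf : ∀ t ∈ Icc 0 T, HasDerivWithinAt f (-f' t) (Icc 0 T) t) {t : ℝ} (ht : t ∈ Ioo 0 T) :
    HasDerivAt (fun t => f (T - t)) (f' (T - t)) t := by
  have ht' : T - t ∈ Ioo 0 T := ⟨by linarith [ht.2], by linarith [ht.1]⟩
  have h := (hf _ (Ioo_subset_Icc_self ht')).hasDerivAt (Icc_mem_nhds ht'.1 ht'.2)
  simpa using h.comp_const_sub T t

theorem integral_comp_sub_eq {T a b : ℝ} {f f' : ℝ → ℝ}
    (hf : ∀ t ∈ Icc 0 T, HasDerivWithinAt f (-f' t) (Icc 0 T) t)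
    (hf' : ContinuousOn f' (Icc 0 T)) (ha : 0 ≤ a) (hab : a ≤ b) (hb : b ≤ T) :
    ∫ t in a..b, f' (T - t) = f (T - b) - f (T - a) := by
  have hsub : Icc a b ⊆ Icc 0 T := Icc_subset_Icc ha hb
  have hc : ContinuousOn f (Icc 0 T) := fun t ht => (hf t ht).continuousWithinAt
  refine integral_eq_of_hasDerivAt_off_countable_of_le (fun t => f (T - t)) _ hab
    countable_empty ((continuousOn_comp_sub hc).mono hsub)
    (fun t ht => hasDerivAt_comp_sub hf (Ioo_subset_Ioo ha hb ht.1)) ?_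
  refine ContinuousOn.intervalIntegrable ?_
  rw [uIcc_of_le hab]
  exact (continuousOn_comp_sub hf').mono hsub

theorem effort_eq_ofReal {T : ℝ} (hT : 0 ≤ T) {u : ℝ → ℝ}
    (hu : IntervalIntegrable (fun t => u t ^ 2 / 2) volume 0 T) :
    effort T u = ENNReal.ofReal (∫ t in (0 : ℝ)..T, u t ^ 2 / 2) := by
  rw [effort, intervalIntegral.integral_of_le hT, ← integral_Icc_eq_integral_Ioc,
    ofReal_integral_eq_lintegral_ofReal ((intervalIntegrable_iff_integrableOn_Icc_of_le hT).1 hu)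
      (Filter.Eventually.of_forall fun t => by positivity)]

theorem HaveCommonTangent.symm {X Y Θ : ℝ → ℝ} {t₁ t₂ : ℝ}
    (h : HaveCommonTangent X Y Θ t₁ t₂) : HaveCommonTangent X Y Θ t₂ t₁ := by
  obtain ⟨h1, h2⟩ := h
  refine ⟨by linarith, ?_⟩
  have h3 := Real.sin_sq_add_cos_sq (Θ t₁)
  -- The unit velocities are parallel, so the one at `t₂` is `cos (Θ t₁ - Θ t₂)` times the one at
  -- `t₁`.
  have hc : Real.cos (Θ t₂) = (Real.cos (Θ t₁) * Real.cos (Θ t₂) +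
      Real.sin (Θ t₁) * Real.sin (Θ t₂)) * Real.cos (Θ t₁) := by
    linear_combination -Real.cos (Θ t₂) * h3 - Real.sin (Θ t₁) * h1
  have hs : Real.sin (Θ t₂) = (Real.cos (Θ t₁) * Real.cos (Θ t₂) +
      Real.sin (Θ t₁) * Real.sin (Θ t₂)) * Real.sin (Θ t₁) := by
    linear_combination -Real.sin (Θ t₂) * h3 + Real.cos (Θ t₁) * h1
  linear_combination (Y t₂ - Y t₁) * hc - (X t₂ - X t₁) * hs - (Real.cos (Θ t₁) * Real.cos (Θ t₂) +
      Real.sin (Θ t₁) * Real.sin (Θ t₂)) * h2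

namespace IsBackwardSolution

variable {q : Param} {T : ℝ} {X Y Θ : ℝ → ℝ}

theorem continuousOn_X (hZ : IsBackwardSolution q T X Y Θ) : ContinuousOn X (Icc 0 T) :=
  fun t ht => (hZ.deriv_X t ht).continuousWithinAt

theorem continuousOn_Y (hZ : IsBackwardSolution q T X Y Θ) : ContinuousOn Y (Icc 0 T) :=
  fun t ht => (hZ.deriv_Y t ht).continuousWithinAt

theorem continuousOn_Θ (hZ : IsBackwardSolution q T X Y Θ) : ContinuousOn Θ (Icc 0 T) :=
  fun t ht => (hZ.deriv_Θ t ht).continuousWithinAt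

theorem continuousOn_control (hZ : IsBackwardSolution q T X Y Θ) :
    ContinuousOn (extremalControl q X Y) (Icc 0 T) :=
  ((continuousOn_const.mul hZ.continuousOn_Y).sub
    (continuousOn_const.mul hZ.continuousOn_X)).add continuousOn_const

theorem integral_cos (hZ : IsBackwardSolution q T X Y Θ) {a b : ℝ} (ha : 0 ≤ a) (hab : a ≤ b)
    (hb : b ≤ T) : ∫ t in a..b, Real.cos (Θ (T - t)) = X (T - b) - X (T - a) :=
  integral_comp_sub_eq (f' := fun t => Real.cos (Θ t)) hZ.deriv_X
    (Real.continuous_cos.comp_continuousOn hZ.continuousOn_Θ) ha hab hb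

theorem integral_sin (hZ : IsBackwardSolution q T X Y Θ) {a b : ℝ} (ha : 0 ≤ a) (hab : a ≤ b)
    (hb : b ≤ T) : ∫ t in a..b, Real.sin (Θ (T - t)) = Y (T - b) - Y (T - a) :=
  integral_comp_sub_eq (f' := fun t => Real.sin (Θ t)) hZ.deriv_Y
    (Real.continuous_sin.comp_continuousOn hZ.continuousOn_Θ) ha hab hb

theorem integral_control (hZ : IsBackwardSolution q T X Y Θ) {a b : ℝ} (ha : 0 ≤ a)
    (hab : a ≤ b) (hb : b ≤ T) :
    ∫ t in a..b, extremalControl q X Y (T - t) = Θ (T - b) - Θ (T - a) :=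
  integral_comp_sub_eq hZ.deriv_Θ hZ.continuousOn_control ha hab hb

theorem isFeasible (hZ : IsBackwardSolution q T X Y Θ) (hT : 0 ≤ T) :
    IsFeasible T (backwardState X Y Θ T) (fun t => backwardState X Y Θ (T - t))
      (fun t => extremalControl q X Y (T - t)) where
  traj :=
    { integrable := by
        refine ContinuousOn.intervalIntegrable ?_
        rw [uIcc_of_le hT]
        exact continuousOn_comp_sub hZ.continuousOn_control
      eq_x := fun t ht => by
        simp only [backwardState, Real.Angle.cos_coe, hZ.integral_cos le_rfl ht.1 ht.2]
        ring
      eq_y := fun t ht => by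
        simp only [backwardState, Real.Angle.sin_coe, hZ.integral_sin le_rfl ht.1 ht.2]
        ring
      eq_θ := fun t ht => by
        simp only [backwardState, hZ.integral_control le_rfl ht.1 ht.2, ← Real.Angle.coe_add]
        congr 1
        ring }
  initial := by simp
  final := by simp [backwardState, finalState, hZ.X_zero, hZ.Y_zero, hZ.Θ_zero]

theorem exists_smaller_effort (hZ : IsBackwardSolution q T X Y Θ)
    (hne : ∃ t ∈ Icc 0 T, Θ t ≠ -(Real.pi / 2)) {t₁ t₂ : ℝ} (ht₁ : 0 < t₁) (h : t₁ < t₂)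
    (ht₂ : t₂ < T) (htan : HaveCommonTangent X Y Θ t₁ t₂) :
    ∃ z w, IsFeasible T (backwardState X Y Θ T) z w ∧
      effort T w < effort T (fun t => extremalControl q X Y (T - t)) := by
  have hT : 0 < T := ht₁.trans (h.trans ht₂)
  -- Constant extension beyond `[0, T]` gives a control continuous on the whole line, and so a lift
  -- `θ` differentiable everywhere.
  set u : ℝ → ℝ := fun t => IccExtend hT.le ((Icc 0 T).domRestrict (extremalControl q X Y)) (T - t)
    with hu
  have huc : Continuous u :=
    (hZ.continuousOn_control.domRestrict.Icc_extend').comp (continuous_const.sub continuous_id)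
  have hu_eq : ∀ t ∈ Icc 0 T, u t = extremalControl q X Y (T - t) := fun t ht =>
    IccExtend_of_mem hT.le _ (show T - t ∈ Icc 0 T from ⟨by linarith [ht.2], by linarith [ht.1]⟩)
  set θ : ℝ → ℝ := fun t => Θ T + ∫ s in (0 : ℝ)..t, u s with hθ
  have hθd : ∀ t, HasDerivAt θ (u t) t := fun t =>
    (huc.integral_hasStrictDerivAt 0 t).hasDerivAt.const_add (Θ T)
  have hθ_eq : ∀ t ∈ Icc 0 T, θ t = Θ (T - t) := by
    intro t ht
    have e : ∫ s in (0 : ℝ)..t, u s = ∫ s in (0 : ℝ)..t, extremalControl q X Y (T - s) := by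
      refine intervalIntegral.integral_congr fun s hs => ?_
      rw [uIcc_of_le ht.1] at hs
      exact hu_eq s ⟨hs.1, hs.2.trans ht.2⟩
    simp only [hθ]
    rw [e, hZ.integral_control le_rfl ht.1 ht.2, sub_zero]
    ring
  have hu' : ∀ t ∈ Ioo 0 T, HasDerivAt u (q.px * Real.sin (θ t) + -q.py * Real.cos (θ t)) t := by
    intro t ht
    have h1 := ((hasDerivAt_comp_sub (f' := fun t => Real.sin (Θ t)) hZ.deriv_Y ht).const_mul
      q.px).sub ((hasDerivAt_comp_sub (f' := fun t => Real.cos (Θ t)) hZ.deriv_X ht).const_mul q.py)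
    have h2 := h1.add_const q.c0
    rw [hθ_eq t (Ioo_subset_Icc_self ht), neg_mul, ← sub_eq_add_neg]
    refine h2.congr_of_eventuallyEq ?_
    filter_upwards [Ioo_mem_nhds ht.1 ht.2] with s hs
    exact hu_eq s (Ioo_subset_Icc_self hs)
  have m₁ : T - t₁ ∈ Icc 0 T := ⟨by linarith, by linarith⟩
  have m₂ : T - t₂ ∈ Icc 0 T := ⟨by linarith, by linarith⟩
  have hcos : ∀ a b, 0 ≤ a → a ≤ b → b ≤ T →
      ∫ t in a..b, Real.cos (θ t) = X (T - b) - X (T - a) := by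
    intro a b ha hab hb
    rw [← hZ.integral_cos ha hab hb]
    refine intervalIntegral.integral_congr fun s hs => ?_
    rw [uIcc_of_le hab] at hs
    simp only [hθ_eq s ⟨ha.trans hs.1, hs.2.trans hb⟩]
  have hsin : ∀ a b, 0 ≤ a → a ≤ b → b ≤ T →
      ∫ t in a..b, Real.sin (θ t) = Y (T - b) - Y (T - a) := by
    intro a b ha hab hb
    rw [← hZ.integral_sin ha hab hb]
    refine intervalIntegral.integral_congr fun s hs => ?_
    rw [uIcc_of_le hab] at hs
    simp only [hθ_eq s ⟨ha.trans hs.1, hs.2.trans hb⟩]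
  have hθc : Continuous θ := continuous_iff_continuousAt.2 fun t => (hθd t).continuousAt
  -- Time reversal swaps the instants: the arc now starts at `T - t₂`, so the chord condition is
  -- needed with the heading at `t₂`, which `htan.symm` supplies.
  obtain ⟨w, hw, hw2, hws, hwc, hwx, hwy, hlt⟩ := exists_control_of_double_tangent
    (s₁ := T - t₂) (s₂ := T - t₁) huc hθd hu' (by linarith) (by linarith) (by linarith)
    (by
      rw [hθ_eq _ m₁, hθ_eq _ m₂, sub_sub_cancel, sub_sub_cancel, Real.sin_sub]
      linarith [htan.1])
    (by
      simp only [Real.sin_sub]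
      rw [intervalIntegral.integral_sub (Continuous.intervalIntegrable (by fun_prop) _ _)
        (Continuous.intervalIntegrable (by fun_prop) _ _), intervalIntegral.integral_mul_const,
        intervalIntegral.integral_mul_const, hcos _ _ m₂.1 (by linarith) m₁.2,
        hsin _ _ m₂.1 (by linarith) m₁.2, hθ_eq _ m₂, sub_sub_cancel, sub_sub_cancel]
      linarith [htan.symm.2])
    (by
      rintro ⟨k, hk⟩
      have h1 : EqOn Θ (fun _ => k) (Ioo 0 T) := fun t ht => by
        have ht' : T - t ∈ Ioo 0 T := ⟨by linarith [ht.2], by linarith [ht.1]⟩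
        have h2 := hk _ ht'
        rwa [hθ_eq _ (Ioo_subset_Icc_self ht'), sub_sub_cancel] at h2
      -- Continuity carries constancy to the endpoints, where `Θ 0` fixes the constant as `-π/2`.
      have h2 := h1.of_subset_closure hZ.continuousOn_Θ continuousOn_const Ioo_subset_Icc_self
        (closure_Ioo hT.ne).ge
      obtain ⟨t, ht, hne⟩ := hne
      apply hne
      rw [h2 ht, ← hZ.Θ_zero, h2 (left_mem_Icc.2 hT.le)])
  have hθ0 : θ 0 = Θ T := by simp [hθ]
  have hend : ((θ 0 + ∫ s in (0 : ℝ)..T, w s : ℝ) : Real.Angle) = (Θ 0 : Real.Angle) := by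
    rw [← sub_eq_zero, ← Real.Angle.coe_sub, ← sub_self T, ← hθ_eq T (right_mem_Icc.2 hT.le)]
    refine Real.Angle.cos_sin_inj ?_ ?_
    · simpa using hwc
    · simpa using hws
  refine ⟨fun t => ⟨X T + ∫ s in (0 : ℝ)..t, Real.cos (θ 0 + ∫ r in (0 : ℝ)..s, w r),
    Y T + ∫ s in (0 : ℝ)..t, Real.sin (θ 0 + ∫ r in (0 : ℝ)..s, w r),
    ((θ 0 + ∫ s in (0 : ℝ)..t, w s : ℝ) : Real.Angle)⟩, w, ⟨⟨hw, ?_, ?_, ?_⟩, ?_, ?_⟩, ?_⟩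
  · intro t _
    simp only [Real.Angle.cos_coe, intervalIntegral.integral_same, add_zero]
  · intro t _
    simp only [Real.Angle.sin_coe, intervalIntegral.integral_same, add_zero]
  · intro t _
    simp only [intervalIntegral.integral_same, add_zero, Real.Angle.coe_add]
  · simp [backwardState, hθ0]
  · simp only [finalState]
    rw [hwx, hwy, hend, hcos 0 T le_rfl hT.le le_rfl, hsin 0 T le_rfl hT.le le_rfl, hZ.Θ_zero]
    simp [hZ.X_zero, hZ.Y_zero]
  · have e : effort T (fun t => extremalControl q X Y (T - t)) = effort T u := by
      refine setLIntegral_congr_fun measurableSet_Icc fun t ht => ?_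
      simp only [hu_eq t ht]
    rw [e, effort_eq_ofReal hT.le hw2,
      effort_eq_ofReal hT.le (Continuous.intervalIntegrable (by fun_prop) _ _)]
    exact (ENNReal.ofReal_lt_ofReal_iff_of_nonneg
      (intervalIntegral.integral_nonneg hT.le fun t _ => by positivity)).2 hlt

end IsBackwardSolution

end MECP

theorem lemma2 (q : MECP.Param) (tf : ℝ) (X Y Θ : ℝ → ℝ)
    (hZ : MECP.IsBackwardSolution q tf X Y Θ)
    (hne : ∃ t ∈ Set.Icc 0 tf, Θ t ≠ -(Real.pi / 2))
    (t₁ t₂ : ℝ) (ht₁ : t₁ ∈ Set.Ioo 0 tf) (ht₂ : t₂ ∈ Set.Ioo 0 tf) (h₁₂ : t₁ ≠ t₂)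
    (htan : MECP.HaveCommonTangent X Y Θ t₁ t₂) :
    MECP.IsFeasible tf (MECP.backwardState X Y Θ tf)
        (fun t => MECP.backwardState X Y Θ (tf - t))
        (fun t => MECP.extremalControl q X Y (tf - t)) ∧
      ¬ MECP.IsOptimal tf (MECP.backwardState X Y Θ tf)
        (fun t => MECP.backwardState X Y Θ (tf - t))
        (fun t => MECP.extremalControl q X Y (tf - t)) := by
  refine ⟨hZ.isFeasible (ht₁.1.trans ht₁.2).le, fun hopt => ?_⟩
  obtain ⟨z, w, hw, hlt⟩ : ∃ z w, MECP.IsFeasible tf (MECP.backwardState X Y Θ tf) z w ∧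
      MECP.effort tf w < MECP.effort tf (fun t => MECP.extremalControl q X Y (tf - t)) := by
    rcases lt_or_gt_of_ne h₁₂ with h | h
    · exact hZ.exists_smaller_effort hne ht₁.1 h ht₂.2 htan
    · exact hZ.exists_smaller_effort hne ht₂.1 h ht₁.2 htan.symm
  exact (hopt.2 z w hw).not_gt hlt
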